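/- Let $n \ge 1$. For a convex body $K \subset \mathbb{R}^n$ with the origin in its interior let $N(x)$ denote the outer unit normal at $x \in \partial K$, and let $\mathcal{C}^n$ be the class of all such $K$ that admit an inner and an outer rolling ball: there are $r, R > 0$ with $B(x - rN(x), r) \subseteq K \subseteq B(x - RN(x), R)$ for every $x \in \partial K$ (and every outer unit normal $N(x)$ at $x$), where $B(y,s)$ is the closed Euclidean ball with centre $y$ and radius $s$. For $1 \le j \le n-1$ let $H_j$ be the $j$-th elementary symmetric function of the principal curvatures of $\partial K$ (the eigenvalues of the differential of the Gauss map $N$ on the tangent hyperplane, which exist almost everywhere on $\partial K$ for $K\in\mathcal C^n$), divided by $\binom{n-1}{j}$, and put $H_0 = 1$. For $p \in \mathbb{R}$, $p \ne -n$, and integers $m, k \ge 0$ put $$\mathcal{W}^p_{m,k}(K) = \int_{\partial K} \langle x, N(x)\rangle^{m-k+\frac{n(1-p)}{n+p}} H_{n-1}^{\frac{p}{n+p}} \sum_{\substack{i_1,\dots,i_{n-1}\ge 0\\ i_1+2i_2+\dots+(n-1)i_{n-1}=m}} c(n,p,i) \prod_{j=1}^{n-1} \binom{n-1}{j}^{i_j}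 H_j^{i_j}\, d\mathcal{H}^{n-1}(x),$$ $$c(n,p,i) = \binom{\frac{n}{n+p}}{i_1+\dots+i_{n-1}} \binom{i_1+\dots+i_{n-1}}{i_1,\dots,i_{n-1}}, \qquad \mathcal{V}^p_k(K) = \sum_{m=0}^k \binom{\frac{n(1-p)}{n+p}}{k-m} \mathcal{W}^p_{m,k}(K),$$ with generalized binomial coefficients $\binom{\alpha}{l} = \alpha(\alpha-1)\cdots(\alpha-l+1)/l!$ and multinomial coefficients, and with $\mathcal{H}^{n-1}$ the surface area measure. Theorem. Let $K \in \mathcal{C}^n$ and let $p \in \mathbb{R}$ with $p \ge 0$ or $p < -n$. Then for all integers $m, k \ge 0$ the integral that defines $\mathcal{W}^p_{m,k}(K)$ converges absolutely, so that $\mathcal{W}^p_{m,k}(K)$ and $\mathcal{V}^p_k(K)$ are finite, and: (i) for every $a > 0$, $\mathcal{W}^p_{m,k}(aK) = a^{\,n\frac{n-p}{n+p}-k}\, \mathcal{W}^p_{m,k}(K)$ and $\mathcal{V}^p_k(aK) = a^{\,n\frac{n-p}{n+p}-k}\, \mathcal{V}^p_k(K)$; (ii) for every linear isometry $T$ of $\mathbb{R}^n$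 (in particular every rotation about the origin and every reflection in a hyperplane through the origin), $\mathcal{W}^p_{m,k}(T(K)) = \mathcal{W}^p_{m,k}(K)$ and $\mathcal{V}^p_k(T(K)) = \mathcal{V}^p_k(K)$. -/

import Mathlib

open Set MeasureTheory
open scoped Pointwise RealInnerProductSpace

noncomputable section

namespace LpSteiner

/-- Euclidean space `ℝⁿ`. -/
abbrev E (n : ℕ) : Type := EuclideanSpace ℝ (Fin n)

variable {n : ℕ}

/-- `u` is an outer unit normal vector of `K` at `x`. -/
def IsOuterUnitNormal (K : Set (E n)) (x u : E n) : Prop :=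
  ‖u‖ = 1 ∧ ∀ y ∈ K, ⟪y - x, u⟫ ≤ 0

/-- The convex bodies in `ℝⁿ` that contain the origin in their interior. -/
def convexBodiesAroundOrigin (n : ℕ) : Set (Set (E n)) :=
  {K | Convex ℝ K ∧ IsCompact K ∧ (0 : E n) ∈ interior K}

/-- `K` admits an inner rolling ball of radius `r`. -/
def HasInnerRollingBall (K : Set (E n)) (r : ℝ) : Prop :=
  0 < r ∧ ∀ x ∈ frontier K, ∀ u, IsOuterUnitNormal K x u → Metric.closedBall (x - r • u) r ⊆ K

/-- `K` admits an outer rolling ball of radius `R`. -/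
def HasOuterRollingBall (K : Set (E n)) (R : ℝ) : Prop :=
  0 < R ∧ ∀ x ∈ frontier K, ∀ u, IsOuterUnitNormal K x u → K ⊆ Metric.closedBall (x - R • u) R

/-- The class `𝒞ⁿ` of convex bodies with the origin in the interior that admit an inner and an
outer rolling ball. -/
def rollingClass (n : ℕ) : Set (Set (E n)) :=
  {K | K ∈ convexBodiesAroundOrigin n ∧
    (∃ r, HasInnerRollingBall K r) ∧ ∃ R, HasOuterRollingBall K R}

open Classical in
/-- The Gauss map `N`: the outer unit normal of `K` at `x` where it exists and is unique
(at every boundary point, if `K` is in `rollingClass n`), and `0` elsewhere. -/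
def gaussMap (K : Set (E n)) (x : E n) : E n :=
  if h : ∃! u, IsOuterUnitNormal K x u then h.choose else 0

/-- The tangent hyperplane (as a linear subspace) of `K` at `x`: the orthogonal complement of the
normal. -/
abbrev tangentSpace (K : Set (E n)) (x : E n) : Submodule ℝ (E n) :=
  (ℝ ∙ gaussMap K x)ᗮ

/-- The Weingarten map at `x`: the differential of the Gauss map along `∂K`, as an endomorphism of
the tangent hyperplane (the differential of a map of unit vectors takes its values there, so that
the orthogonal projection only adjusts the codomain).
It is `0` where the Gauss map is not differentiable along `∂K`. -/
def weingartenMap (K : Set (E n)) (x : E n) : tangentSpace K x →L[ℝ] tangentSpace K x :=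
  (tangentSpace K x).orthogonalProjectionOnto ∘L
    fderivWithin ℝ (gaussMap K) (frontier K) x ∘L (tangentSpace K x).subtypeL

open Classical in
/-- The principal curvatures of `K` at `x`: the eigenvalues, with multiplicity, of the Weingarten
map. (The Weingarten map is always symmetric on the boundary of a body in `rollingClass n`; the `if`
only provides Mathlib's `eigenvalues` with a proof of this.) -/
def principalCurvatures (K : Set (E n)) (x : E n) : Multiset ℝ :=
  if h : (weingartenMap K x : tangentSpace K x →ₗ[ℝ] tangentSpace K x).IsSymmetric then
    Finset.univ.val.map (h.eigenvalues rfl)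
  else 0

/-- `H_j`, the `j`-th normalized elementary symmetric function of the `n - 1` principal
curvatures. -/
def normalizedCurvature (K : Set (E n)) (j : ℕ) (x : E n) : ℝ :=
  ((n - 1).choose j : ℝ)⁻¹ * (principalCurvatures K x).esymm j

/-- The tuples `(i₁, …, i_{n-1})` of natural numbers with `i₁ + 2 i₂ + ⋯ + (n-1) i_{n-1} = m`;
position `j : Fin (n - 1)` holds the entry `i_{j+1}`. All entries are at most `m`. -/
def indexTuples (n m : ℕ) : Finset (Fin (n - 1) → ℕ) :=
  (Fintype.piFinset fun _ => Finset.range (m + 1)).filter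
    fun i => ∑ j : Fin (n - 1), ((j : ℕ) + 1) * i j = m

/-- `c(n, p, i)`, a generalized binomial coefficient times a multinomial coefficient. -/
def tupleCoeff (n : ℕ) (p : ℝ) (i : Fin (n - 1) → ℕ) : ℝ :=
  Ring.choose ((n : ℝ) / (n + p)) (∑ j, i j) * (Nat.multinomial Finset.univ i : ℝ)

/-- The integrand of the `L_p` Steiner coefficient `𝒲^p_{m,k}(K)`. -/
def steinerIntegrand (p : ℝ) (m k : ℕ) (K : Set (E n)) (x : E n) : ℝ :=
  ⟪x, gaussMap K x⟫ ^ ((m : ℝ) - k + n * (1 - p) / (n + p)) *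
    normalizedCurvature K (n - 1) x ^ (p / (n + p)) *
    ∑ i ∈ indexTuples n m, tupleCoeff n p i *
      ∏ j : Fin (n - 1),
        (((n - 1).choose ((j : ℕ) + 1) : ℝ) * normalizedCurvature K ((j : ℕ) + 1) x) ^ i j

/-- The `L_p` Steiner coefficient `𝒲^p_{m,k}(K)`, an integral with respect to the
`(n-1)`-dimensional Hausdorff measure on `∂K`, normalized to be the usual surface area. -/
def steinerCoeff (p : ℝ) (m k : ℕ) (K : Set (E n)) : ℝ :=
  ∫ x in frontier K, steinerIntegrand p m k K x ∂μHE[n - 1]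

/-- The `L_p`-Steiner quermassintegral `𝒱^p_k(K)`. -/
def steinerQuermassintegral (p : ℝ) (k : ℕ) (K : Set (E n)) : ℝ :=
  ∑ m ∈ Finset.range (k + 1),
    Ring.choose ((n : ℝ) * (1 - p) / (n + p)) (k - m) * steinerCoeff p m k K

end LpSteiner

end

/-!
The integrand turns out to be a bounded measurable function on a set of finite area, and every factor
of it is homogeneous under the similarities `x ↦ a T x`. The regularity
comes from the inner rolling ball of `K`, whose radius is `r` below.

*Regularity.* Comparing the rolling ball at one boundary point with the supporting hyperplane at
another gives `r ‖N(x) - N(y)‖ ≤ ‖x - y‖` (`HasInnerRollingBall.mul_norm_sub_le`), so the Gauss map is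
well defined and Lipschitz on `∂K`. At `x ∈ ∂K` the gauge of `K` is squeezed between the linear
function of the supporting half-space and the same function plus a quadratic error that comes from
the rolling ball; it is therefore differentiable there, and so is the radial projection
`y ↦ y / gauge K y` onto `∂K`. Composing the Gauss map with this projection gives an extended Gauss
map on `ℝⁿ ∖ {0}` whose Fréchet derivative at `x ∈ ∂K` agrees on the tangent hyperplane with the
differential of `N` along `∂K` (`fderivWithin_gaussMap_apply`). This settles the two delicate points:
derivatives along `∂K` become Fréchet derivatives, hence unique and measurable in `x`, and they are
bounded because the extended map is Lipschitz at boundary points with a uniform constant.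

*Curvatures.* The Weingarten map, extended by `0` in the normal direction, is an operator on `ℝⁿ`
whose characteristic polynomial is `X` times the original one. Its coefficients, which are
homogeneous polynomials in the entries of the operator, are up to sign the elementary symmetric
functions of the principal curvatures (`normalizedCurvature_eq`). The curvatures `H_j` are thus
bounded and measurable on `∂K`; the case distinction on symmetry in `principalCurvatures` does no
harm, because the symmetric operators form a closed set. Since `p / (n + p) ≥ 0`, the power of `H_{n-1}` is bounded, and the
support function `⟪x, N(x)⟫` lies in a compact subinterval of `(0, ∞)`.

*Area.* Boundary points with normals close to a fixed unit vector `e` are separated by the orthogonal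
projection along `e`, whose inverse is Lipschitz on this set; so `∂K` has locally finite
`(n-1)`-dimensional Hausdorff measure, and finite measure by compactness.

*Homogeneity.* Under `x ↦ a T x` the normal is rotated by `T`, the support function is multiplied by
`a`, `H_j` by `a⁻ʲ` and the area by `aⁿ⁻¹`; the exponents add up to `n (n - p) / (n + p) - k`
(`steinerIntegrand_similarity`). Dilations are the case `T = id`, isometries the case `a = 1`.
-/

noncomputable section

namespace LpSteiner

variable {n : ℕ} {K : Set (E n)}

/-! ### Outer unit normals -/

theorem exists_isOuterUnitNormal (hK : K ∈ convexBodiesAroundOrigin n) {x : E n}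
    (hx : x ∈ frontier K) : ∃ u, IsOuterUnitNormal K x u := by
  obtain ⟨hconv, hcomp, h0⟩ := hK
  obtain ⟨f, hf⟩ := geometric_hahn_banach_open_point hconv.interior isOpen_interior hx.2
  set w : E n := (InnerProductSpace.toDual ℝ (E n)).symm f with hw
  have hfw : ∀ y, f y = ⟪y, w⟫ := fun y => by
    rw [real_inner_comm, hw, InnerProductSpace.toDual_symm_apply]
  have hle : ∀ y ∈ K, f y ≤ f x := by
    intro y hy
    have hy' : y ∈ closure (interior K) := by
      rw [hconv.closure_interior_eq_closure_of_nonempty_interior ⟨0, h0⟩]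
      exact subset_closure hy
    exact closure_minimal (fun z hz => (hf z hz).le)
      (isClosed_le f.continuous continuous_const) hy'
  have hw0 : w ≠ 0 := by
    intro h
    have := hf 0 h0
    simp [hfw, h] at this
  have hn : 0 < ‖w‖ := norm_pos_iff.2 hw0
  refine ⟨‖w‖⁻¹ • w, by simp [norm_smul, hn.ne'], fun y hy => ?_⟩
  rw [inner_smul_right, inner_sub_left, ← hfw, ← hfw]
  exact mul_nonpos_of_nonneg_of_nonpos (by positivity) (sub_nonpos.2 (hle y hy))

/-- An inner rolling ball of radius `r` makes the normal `r⁻¹`-Lipschitz: the point of the ball at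
`x` that lies farthest in the direction `v` stays below the supporting hyperplane at `y`, and
conversely. -/
theorem HasInnerRollingBall.mul_norm_sub_le {r : ℝ} (hr : HasInnerRollingBall K r) {x y u v : E n}
    (hx : x ∈ frontier K) (hy : y ∈ frontier K) (hu : IsOuterUnitNormal K x u)
    (hv : IsOuterUnitNormal K y v) : r * ‖u - v‖ ≤ ‖x - y‖ := by
  have key : ∀ {x y u v : E n}, x ∈ frontier K → IsOuterUnitNormal K x u →
      IsOuterUnitNormal K y v → ⟪x - y, v⟫ ≤ - (r * (1 - ⟪u, v⟫)) := by
    intro x y u v hx hu hv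
    have hmem : x - r • u + r • v ∈ K := hr.2 x hx u hu (by
      rw [mem_closedBall_iff_norm, add_sub_cancel_left, norm_smul, hv.1, Real.norm_eq_abs,
        abs_of_pos hr.1, mul_one])
    have h := hv.2 _ hmem
    have e : x - r • u + r • v - y = (x - y) + (r • v - r • u) := by abel
    rw [e, inner_add_left, inner_sub_left (r • v), inner_smul_left, inner_smul_left,
      real_inner_self_eq_norm_sq, hv.1] at h
    simp only [conj_trivial] at h
    linarith
  have h1 := key hx hu hv
  have h2 := key hy hv hu
  rw [real_inner_comm u v] at h2
  have h3 : ‖u - v‖ ^ 2 = 2 * (1 - ⟪u, v⟫) := by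
    rw [norm_sub_sq_real, hu.1, hv.1]; ring
  have h4 : r * ‖u - v‖ ^ 2 ≤ ⟪x - y, u - v⟫ := by
    rw [h3, inner_sub_right]
    have : ⟪y - x, u⟫ = - ⟪x - y, u⟫ := by rw [← inner_neg_left, neg_sub]
    linarith
  have h5 := h4.trans (real_inner_le_norm _ _)
  rcases (norm_nonneg (u - v)).eq_or_lt with h | h
  · rw [← h]; simp
  · exact le_of_mul_le_mul_right (by linarith [h5, sq (‖u - v‖)]) h

theorem isOuterUnitNormal_gaussMap {r : ℝ} (hK : K ∈ convexBodiesAroundOrigin n)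
    (hr : HasInnerRollingBall K r) {x : E n} (hx : x ∈ frontier K) :
    IsOuterUnitNormal K x (gaussMap K x) := by
  have h : ∃! u, IsOuterUnitNormal K x u := by
    obtain ⟨u, hu⟩ := exists_isOuterUnitNormal hK hx
    refine ⟨u, hu, fun v hv => ?_⟩
    have := hr.mul_norm_sub_le hx hx hv hu
    rw [sub_self, norm_zero] at this
    have h0 : ‖v - u‖ ≤ 0 := by
      by_contra! h
      exact absurd this (not_le.2 (mul_pos hr.1 h))
    exact sub_eq_zero.1 (norm_le_zero_iff.1 h0)
  rw [gaussMap, dif_pos h]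
  exact h.choose_spec.1

theorem norm_gaussMap_sub_le {r : ℝ} (hK : K ∈ convexBodiesAroundOrigin n)
    (hr : HasInnerRollingBall K r) {x y : E n} (hx : x ∈ frontier K) (hy : y ∈ frontier K) :
    ‖gaussMap K x - gaussMap K y‖ ≤ r⁻¹ * ‖x - y‖ := by
  rw [inv_mul_eq_div, le_div_iff₀' hr.1]
  exact hr.mul_norm_sub_le hx hy (isOuterUnitNormal_gaussMap hK hr hx)
    (isOuterUnitNormal_gaussMap hK hr hy)

theorem continuousOn_gaussMap {r : ℝ} (hK : K ∈ convexBodiesAroundOrigin n)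
    (hr : HasInnerRollingBall K r) : ContinuousOn (gaussMap K) (frontier K) := by
  have : LipschitzOnWith (Real.toNNReal r⁻¹) (gaussMap K) (frontier K) :=
    LipschitzOnWith.of_dist_le_mul fun x hx y hy => by
      rw [dist_eq_norm, dist_eq_norm, Real.coe_toNNReal _ (inv_nonneg.2 hr.1.le)]
      exact norm_gaussMap_sub_le hK hr hx hy
  exact this.continuousOn

/-- The support function of a body around the origin is bounded below by the radius of a ball
around the origin in the body. -/
theorem exists_pos_le_inner_of_isOuterUnitNormal (h0 : (0 : E n) ∈ interior K) :
    ∃ ρ > 0, ∀ x u, IsOuterUnitNormal K x u → ρ ≤ ⟪x, u⟫ := by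
  obtain ⟨ρ, hρ, hb⟩ := Metric.nhds_basis_closedBall.mem_iff.1 (mem_interior_iff_mem_nhds.1 h0)
  refine ⟨ρ, hρ, fun x u hu => ?_⟩
  have := hu.2 (ρ • u) (hb (by simp [norm_smul, hu.1, abs_of_pos hρ]))
  rw [inner_sub_left, inner_smul_left, real_inner_self_eq_norm_sq, hu.1] at this
  simp only [conj_trivial] at this
  linarith

theorem IsOuterUnitNormal.inner_pos (h0 : (0 : E n) ∈ interior K) {x u : E n}
    (hu : IsOuterUnitNormal K x u) : 0 < ⟪x, u⟫ := by
  obtain ⟨ρ, hρ, h⟩ := exists_pos_le_inner_of_isOuterUnitNormal h0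
  exact hρ.trans_le (h x u hu)

/-! ### The radial projection onto the boundary -/

/-- The radial projection of `ℝⁿ ∖ {0}` onto `∂K`; it sends `0` to `0`. -/
def radialProj (K : Set (E n)) (y : E n) : E n := (gauge K y)⁻¹ • y

theorem gauge_eq_one (hK : K ∈ convexBodiesAroundOrigin n) {x : E n} (hx : x ∈ frontier K) :
    gauge K x = 1 :=
  (gauge_eq_one_iff_mem_frontier hK.1 (mem_interior_iff_mem_nhds.1 hK.2.2)).2 hx

theorem gauge_pos_of_ne_zero (hK : K ∈ convexBodiesAroundOrigin n) {y : E n} (hy : y ≠ 0) :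
    0 < gauge K y :=
  (gauge_pos (absorbent_nhds_zero (mem_interior_iff_mem_nhds.1 hK.2.2))
    (NormedSpace.isVonNBounded_iff ℝ |>.2 hK.2.1.isBounded)).2 hy

theorem radialProj_mem_frontier (hK : K ∈ convexBodiesAroundOrigin n) {y : E n} (hy : y ≠ 0) :
    radialProj K y ∈ frontier K := by
  rw [← gauge_eq_one_iff_mem_frontier hK.1 (mem_interior_iff_mem_nhds.1 hK.2.2), radialProj,
    gauge_smul_of_nonneg (inv_nonneg.2 (gauge_nonneg y)), smul_eq_mul,
    inv_mul_cancel₀ (gauge_pos_of_ne_zero hK hy).ne']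

theorem radialProj_of_mem_frontier (hK : K ∈ convexBodiesAroundOrigin n) {x : E n}
    (hx : x ∈ frontier K) : radialProj K x = x := by
  simp [radialProj, gauge_eq_one hK hx]

theorem ne_zero_of_mem_frontier (hK : K ∈ convexBodiesAroundOrigin n) {x : E n}
    (hx : x ∈ frontier K) : x ≠ 0 := fun h => hx.2 (h ▸ hK.2.2)

theorem continuousOn_radialProj (hK : K ∈ convexBodiesAroundOrigin n) :
    ContinuousOn (radialProj K) {0}ᶜ := by
  have hg := continuous_gauge hK.1 (mem_interior_iff_mem_nhds.1 hK.2.2)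
  exact (hg.continuousOn.inv₀ fun _ hy => (gauge_pos_of_ne_zero hK hy).ne').smul continuousOn_id

/-- The supporting half-space at `x` bounds the gauge from below. -/
theorem inner_div_le_gauge (hK : K ∈ convexBodiesAroundOrigin n) {x u : E n}
    (hu : IsOuterUnitNormal K x u) (y : E n) : ⟪y, u⟫ / ⟪x, u⟫ ≤ gauge K y := by
  have hpos := hu.inner_pos hK.2.2
  rcases eq_or_ne y 0 with rfl | hy
  · simp
  have hg := gauge_pos_of_ne_zero hK hy
  have hmem := hK.2.1.isClosed.frontier_subset (radialProj_mem_frontier hK hy)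
  have h := hu.2 _ hmem
  rw [inner_sub_left, radialProj, inner_smul_left, sub_nonpos] at h
  simp only [conj_trivial] at h
  rw [div_le_iff₀ hpos]
  rwa [inv_mul_le_iff₀ hg] at h

/-- The inner rolling ball at `x` bounds the gauge from above, with the same linear part at `x` as
the supporting half-space and a quadratic error. -/
theorem gauge_le_inner_div_add {r : ℝ}
    (hr : HasInnerRollingBall K r) {x u : E n} (hx : x ∈ frontier K)
    (hu : IsOuterUnitNormal K x u) (hpos : 0 < ⟪x, u⟫) :
    ∃ C, ∀ᶠ y in nhds x, gauge K y ≤ ⟪y, u⟫ / ⟪x, u⟫ + C * ‖y - x‖ ^ 2 := by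
  set h := ⟪x, u⟫ with hh
  have hr0 := hr.1
  set B : ℝ := 1 + (1 / h + 1) * ‖x‖ with hB
  have hB0 : 0 < B := by positivity
  set C : ℝ := B ^ 2 / (r * h) with hC
  have hC0 : 0 < C := by positivity
  refine ⟨C, ?_⟩
  have hε : 0 < min (h / 2) (1 / C) := by positivity
  filter_upwards [Metric.ball_mem_nhds x hε] with y hy
  rw [mem_ball_iff_norm, lt_min_iff] at hy
  obtain ⟨hy1, hy2⟩ := hy
  set d := ‖y - x‖ with hd
  have hd0 : 0 ≤ d := norm_nonneg _
  set t := ⟪y, u⟫ / h + C * d ^ 2 with ht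
  have hyx : |⟪y - x, u⟫| ≤ d := by
    simpa [hu.1] using abs_real_inner_le_norm (y - x) u
  have e1 : ⟪y, u⟫ / h = 1 + ⟪y - x, u⟫ / h := by
    rw [inner_sub_left, ← hh]; field_simp; ring
  have hq : |⟪y - x, u⟫ / h| ≤ d / h := by
    rw [abs_div, abs_of_pos hpos]; gcongr
  have hCd : C * d ^ 2 ≤ d := by
    have : C * d ≤ 1 := by
      rw [lt_div_iff₀ hC0] at hy2; linarith
    nlinarith
  have hdh : d / h ≤ 1 / 2 := by rw [div_le_iff₀ hpos]; linarith
  have hCd0 : 0 ≤ C * d ^ 2 := by positivity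
  have ht2 : 1 / 2 ≤ t := by
    have := (abs_le.1 hq).1
    rw [ht, e1]; linarith
  have ht0 : 0 < t := by linarith
  have ht1 : |1 - t| ≤ (1 / h + 1) * d := by
    have e : 1 - t = -(⟪y - x, u⟫ / h) - C * d ^ 2 := by rw [ht, e1]; ring
    have := abs_le.1 hq
    rw [e, abs_le, add_mul, one_div_mul_eq_div]
    constructor <;> linarith [this.1, this.2]
  have hyt : ‖y - t • x‖ ≤ B * d := by
    have e : y - t • x = (y - x) + (1 - t) • x := by module
    rw [e]
    refine (norm_add_le _ _).trans ?_
    rw [norm_smul, Real.norm_eq_abs]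
    have := mul_le_mul_of_nonneg_right ht1 (norm_nonneg x)
    rw [hB]; linarith
  have hin : ⟪y - t • x, u⟫ = - (h * C * d ^ 2) := by
    rw [inner_sub_left, inner_smul_left, ← hh, ht]
    simp only [conj_trivial]
    field_simp; ring
  -- `C = B² / (r h)` is what makes `y / t` lie in the rolling ball: the square of the distance of
  -- `y` from `t x` is at most `B² d²`, while the inner product with `u` falls short by `h C d²`.
  have hball : ‖y - t • x + (t * r) • u‖ ≤ t * r := by
    refine le_of_sq_le_sq ?_ (by positivity)
    rw [norm_add_sq_real, inner_smul_right, hin, norm_smul, hu.1, Real.norm_eq_abs,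
      abs_of_pos (by positivity : 0 < t * r)]
    have h1 : ‖y - t • x‖ ^ 2 ≤ B ^ 2 * d ^ 2 := by
      rw [← mul_pow]; exact pow_le_pow_left₀ (norm_nonneg _) hyt 2
    have h2 : B ^ 2 = r * h * C := by rw [hC]; field_simp
    have h3 : 0 ≤ r * h * C * d ^ 2 := by positivity
    have h4 := mul_le_mul_of_nonneg_right ht2 h3
    rw [h2] at h1
    linarith [h1, h4]
  refine gauge_le_of_mem ht0.le ⟨t⁻¹ • y, hr.2 x hx u hu ?_, by simp [smul_smul, ht0.ne']⟩
  rw [mem_closedBall_iff_norm]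
  have e : t⁻¹ • y - (x - r • u) = t⁻¹ • (y - t • x + (t * r) • u) := by
    rw [smul_add, smul_sub, smul_smul, smul_smul, ← mul_assoc, inv_mul_cancel₀ ht0.ne']
    module
  rw [e, norm_smul, norm_inv, Real.norm_eq_abs, abs_of_pos ht0, inv_mul_le_iff₀ ht0]
  exact hball

theorem hasFDerivAt_gauge {r : ℝ} (hK : K ∈ convexBodiesAroundOrigin n)
    (hr : HasInnerRollingBall K r) {x u : E n} (hx : x ∈ frontier K)
    (hu : IsOuterUnitNormal K x u) :
    HasFDerivAt (gauge K) ((⟪x, u⟫)⁻¹ • innerSL ℝ u) x := by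
  have hpos := hu.inner_pos hK.2.2
  obtain ⟨C, hC⟩ := gauge_le_inner_div_add hr hx hu hpos
  rw [hasFDerivAt_iff_isLittleO]
  have hO : (fun y => gauge K y - gauge K x - ((⟪x, u⟫)⁻¹ • innerSL ℝ u) (y - x)) =O[nhds x]
      fun y => ‖y - x‖ ^ 2 := by
    refine Asymptotics.IsBigO.of_bound C ?_
    filter_upwards [hC] with y hy
    have hl := inner_div_le_gauge hK hu y
    have e : ((⟪x, u⟫)⁻¹ • innerSL ℝ u) (y - x) = ⟪y, u⟫ / ⟪x, u⟫ - 1 := by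
      simp only [smul_apply, innerSL_apply_apply, smul_eq_mul, inner_sub_right,
        real_inner_comm]
      field_simp
    rw [e, gauge_eq_one hK hx, Real.norm_eq_abs, Real.norm_eq_abs, abs_of_nonneg (by linarith),
      abs_of_nonneg (by positivity)]
    linarith
  refine hO.trans_isLittleO ?_
  have h1 : Filter.Tendsto (fun y => y - x) (nhds x) (nhds 0) := by
    have : Continuous fun y : E n => y - x := by fun_prop
    simpa using this.tendsto x
  exact (Asymptotics.isLittleO_norm_pow_id (E' := E n) one_lt_two).comp_tendsto h1

/-- The differential of the radial projection at `x ∈ ∂K` with normal `u` is the oblique projection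
onto the tangent hyperplane along `x`. -/
theorem hasFDerivAt_radialProj {r : ℝ} (hK : K ∈ convexBodiesAroundOrigin n)
    (hr : HasInnerRollingBall K r) {x u : E n} (hx : x ∈ frontier K)
    (hu : IsOuterUnitNormal K x u) :
    HasFDerivAt (radialProj K)
      (ContinuousLinearMap.id ℝ (E n) - ((⟪x, u⟫)⁻¹ • innerSL ℝ u).smulRight x) x := by
  have hg := hasFDerivAt_gauge hK hr hx hu
  have h1 := gauge_eq_one hK hx
  have hinv := (hasDerivAt_inv (𝕜 := ℝ) (x := gauge K x) (by simp [h1])).comp_hasFDerivAt x hg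
  have := hinv.smul (hasFDerivAt_id x)
  refine this.congr_fderiv ?_
  ext1 v
  simp [h1, sub_eq_add_neg]

/-- The Gauss map, extended to `ℝⁿ ∖ {0}` as a function that is homogeneous of degree `0`. The
differential of this extension is an ordinary Fréchet derivative. -/
def extendedGaussMap (K : Set (E n)) (y : E n) : E n := gaussMap K (radialProj K y)

theorem extendedGaussMap_of_mem_frontier (hK : K ∈ convexBodiesAroundOrigin n) {x : E n}
    (hx : x ∈ frontier K) : extendedGaussMap K x = gaussMap K x := by
  rw [extendedGaussMap, radialProj_of_mem_frontier hK hx]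

theorem measurable_extendedGaussMap {r : ℝ} (hK : K ∈ convexBodiesAroundOrigin n)
    (hr : HasInnerRollingBall K r) : Measurable (extendedGaussMap K) :=
  measurable_of_continuousOn_compl_singleton 0
    ((continuousOn_gaussMap hK hr).comp (continuousOn_radialProj hK)
      fun _ hy => radialProj_mem_frontier hK hy)

/-- On the tangent hyperplane, the differential of the Gauss map along `∂K` is the Fréchet
derivative of the extended Gauss map; this includes the points without differentiability, where both
are `0`. -/
theorem fderivWithin_gaussMap_apply {r : ℝ} (hK : K ∈ convexBodiesAroundOrigin n)
    (hr : HasInnerRollingBall K r) {x v : E n} (hx : x ∈ frontier K)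
    (hv : ⟪gaussMap K x, v⟫ = 0) :
    fderivWithin ℝ (gaussMap K) (frontier K) x v = fderiv ℝ (extendedGaussMap K) x v := by
  have hu := isOuterUnitNormal_gaussMap hK hr hx
  by_cases hd : DifferentiableWithinAt ℝ (gaussMap K) (frontier K) x
  · have hρ := hasFDerivAt_radialProj hK hr hx hu
    have hd' := hd.hasFDerivWithinAt
    have hev : ∀ᶠ y in nhds x, radialProj K y ∈ frontier K := by
      filter_upwards [isOpen_ne.mem_nhds (ne_zero_of_mem_frontier hK hx)] with y hy
      exact radialProj_mem_frontier hK hy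
    rw [← radialProj_of_mem_frontier hK hx] at hd'
    have hc : HasFDerivAt (extendedGaussMap K) _ x := hd'.comp_hasFDerivAt x hρ hev
    rw [hc.fderiv, radialProj_of_mem_frontier hK hx]
    simp [hv]
  · have hd' : ¬ DifferentiableAt ℝ (extendedGaussMap K) x := fun h =>
      hd ((h.differentiableWithinAt (s := frontier K)).congr
        (fun y hy => (extendedGaussMap_of_mem_frontier hK hy).symm)
        (extendedGaussMap_of_mem_frontier hK hx).symm)
    rw [fderivWithin_zero_of_not_differentiableWithinAt hd, fderiv_zero_of_not_differentiableAt hd']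

/-- The Gauss map is `r⁻¹`-Lipschitz, and the differential of the radial projection at `x` is bounded
by `1 + ‖x‖ / ⟪x, N(x)⟫`. -/
theorem exists_norm_fderiv_extendedGaussMap_le {r : ℝ} (hK : K ∈ convexBodiesAroundOrigin n)
    (hr : HasInnerRollingBall K r) :
    ∃ C, ∀ x ∈ frontier K, ‖fderiv ℝ (extendedGaussMap K) x‖ ≤ C := by
  obtain ⟨ρ, hρ, hle⟩ := exists_pos_le_inner_of_isOuterUnitNormal hK.2.2
  obtain ⟨M, hM⟩ := hK.2.1.isBounded.exists_norm_le
  refine ⟨r⁻¹ * (1 + ρ⁻¹ * M + 1), fun x hx => ?_⟩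
  have hu := isOuterUnitNormal_gaussMap hK hr hx
  have hMx := hM x (hK.2.1.isClosed.frontier_subset hx)
  have hM0 : 0 ≤ M := (norm_nonneg x).trans hMx
  have hr0 := hr.1
  have hD := hasFDerivAt_radialProj hK hr hx hu
  set D := ContinuousLinearMap.id ℝ (E n) -
    ((⟪x, gaussMap K x⟫)⁻¹ • innerSL ℝ (gaussMap K x)).smulRight x with hDdef
  have hDn : ‖D‖ ≤ 1 + ρ⁻¹ * M := by
    refine (norm_sub_le _ _).trans (add_le_add ContinuousLinearMap.norm_id_le ?_)
    rw [ContinuousLinearMap.norm_smulRight_apply, norm_smul, innerSL_apply_norm, hu.1, mul_one,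
      norm_inv, Real.norm_eq_abs, abs_of_pos (hu.inner_pos hK.2.2)]
    have := hle x _ hu
    gcongr
  refine norm_fderiv_le_of_lip' ℝ (by positivity) ?_
  have ho := (hasFDerivAt_iff_isLittleO.1 hD).def one_pos
  filter_upwards [ho, isOpen_ne.mem_nhds (ne_zero_of_mem_frontier hK hx)] with y hy hy0
  rw [radialProj_of_mem_frontier hK hx, one_mul] at hy
  rw [extendedGaussMap_of_mem_frontier hK hx]
  refine (norm_gaussMap_sub_le hK hr (radialProj_mem_frontier hK hy0) hx).trans ?_
  rw [mul_assoc]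
  gcongr
  have h1 : ‖radialProj K y - x‖ ≤ ‖radialProj K y - x - D (y - x)‖ + ‖D (y - x)‖ := by
    simpa using norm_add_le (radialProj K y - x - D (y - x)) (D (y - x))
  have h2 := (D.le_opNorm (y - x)).trans (mul_le_mul_of_nonneg_right hDn (norm_nonneg _))
  linarith

/-! ### Coefficients of characteristic polynomials -/

theorem eval_smul_of_isHomogeneous {σ : Type*} {φ : MvPolynomial σ ℝ} {k : ℕ}
    (hφ : φ.IsHomogeneous k) (c : ℝ) (x : σ → ℝ) :
    MvPolynomial.eval (c • x) φ = c ^ k * MvPolynomial.eval x φ := by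
  rw [MvPolynomial.eval_eq, MvPolynomial.eval_eq, Finset.mul_sum]
  refine Finset.sum_congr rfl fun d hd => ?_
  have hk : ∑ i ∈ d.support, d i = k := by
    have := hφ (MvPolynomial.mem_support_iff.1 hd)
    simpa [Finsupp.weight_apply, Finsupp.sum] using this
  simp only [Pi.smul_apply, smul_eq_mul, mul_pow, Finset.prod_mul_distrib]
  rw [Finset.prod_pow_eq_pow_sum, hk]
  ring

theorem charpoly_coeff_eq_eval (A : E n →L[ℝ] E n) (i : ℕ) :
    (A : E n →ₗ[ℝ] E n).charpoly.coeff i =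
      MvPolynomial.eval (fun q : Fin n × Fin n => A (EuclideanSpace.single q.2 1) q.1)
        ((Matrix.charpoly.univ ℝ (Fin n)).coeff i) := by
  rw [← LinearMap.charpoly_toMatrix _ (EuclideanSpace.basisFun (Fin n) ℝ).toBasis,
    MvPolynomial.eval, Matrix.charpoly.univ_coeff_eval₂Hom]
  congr 2

theorem continuous_charpoly_coeff (i : ℕ) :
    Continuous fun A : E n →L[ℝ] E n => (A : E n →ₗ[ℝ] E n).charpoly.coeff i := by
  simp only [charpoly_coeff_eq_eval]
  refine (MvPolynomial.continuous_eval _).comp (continuous_pi fun q => ?_)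
  fun_prop

theorem charpoly_coeff_smul (c : ℝ) (A : E n →L[ℝ] E n) {j : ℕ} (hj : j ≤ n) :
    ((c • A : E n →L[ℝ] E n) : E n →ₗ[ℝ] E n).charpoly.coeff (n - j) =
      c ^ j * (A : E n →ₗ[ℝ] E n).charpoly.coeff (n - j) := by
  rw [charpoly_coeff_eq_eval, charpoly_coeff_eq_eval]
  exact eval_smul_of_isHomogeneous
    (Matrix.charpoly.univ_coeff_isHomogeneous ℝ (Fin n) (n - j) j (by simp [hj])) c _

open Polynomial in
/-- `f ∘ g` and `g ∘ f` have the same characteristic polynomial up to a power of `X`, also for maps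
between spaces of different dimensions. -/
theorem charpoly_comp_comm {V W : Type*} [AddCommGroup V] [Module ℝ V] [FiniteDimensional ℝ V]
    [AddCommGroup W] [Module ℝ W] [FiniteDimensional ℝ W] (f : V →ₗ[ℝ] W) (g : W →ₗ[ℝ] V) :
    X ^ Module.finrank ℝ V * (f ∘ₗ g).charpoly =
      X ^ Module.finrank ℝ W * (g ∘ₗ f).charpoly := by
  classical
  let b := Module.finBasis ℝ V
  let c := Module.finBasis ℝ W
  rw [← LinearMap.charpoly_toMatrix (f ∘ₗ g) c, ← LinearMap.charpoly_toMatrix (g ∘ₗ f) b,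
    LinearMap.toMatrix_comp c b c, LinearMap.toMatrix_comp b c b]
  simpa using Matrix.charpoly_mul_comm' (LinearMap.toMatrix b c f) (LinearMap.toMatrix c b g)

open Classical in
/-- The `j`-th elementary symmetric function of the eigenvalues of a symmetric operator on `ℝⁿ`,
read off its characteristic polynomial. For an operator that is not symmetric it is, to match
`principalCurvatures`, the elementary symmetric function of the empty multiset. -/
def operatorEsymm (j : ℕ) (A : E n →L[ℝ] E n) : ℝ :=
  if (A : E n →ₗ[ℝ] E n).IsSymmetric then
    (-1) ^ j * (A : E n →ₗ[ℝ] E n).charpoly.coeff (n - j)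
  else (0 : Multiset ℝ).esymm j

theorem isClosed_setOf_isSymmetric :
    IsClosed {A : E n →L[ℝ] E n | (A : E n →ₗ[ℝ] E n).IsSymmetric} := by
  simp only [LinearMap.IsSymmetric, ofPred_forall]
  refine isClosed_iInter fun v => isClosed_iInter fun w => ?_
  refine isClosed_eq ?_ ?_ <;> simp only [ContinuousLinearMap.coe_coe] <;> fun_prop

theorem measurable_operatorEsymm (j : ℕ) :
    Measurable (operatorEsymm j : (E n →L[ℝ] E n) → ℝ) := by
  classical
  unfold operatorEsymm
  exact Measurable.ite isClosed_setOf_isSymmetric.measurableSet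
    ((continuous_charpoly_coeff _).measurable.const_mul _) measurable_const

theorem exists_abs_operatorEsymm_le (j : ℕ) (R : ℝ) :
    ∃ C, ∀ A : E n →L[ℝ] E n, ‖A‖ ≤ R → |operatorEsymm j A| ≤ C := by
  obtain ⟨C, hC⟩ := (isCompact_closedBall (0 : E n →L[ℝ] E n) R).exists_bound_of_continuousOn
    (continuous_charpoly_coeff (n - j)).continuousOn
  refine ⟨max C |(0 : Multiset ℝ).esymm j|, fun A hA => ?_⟩
  unfold operatorEsymm
  split_ifs with h
  · rw [abs_mul, abs_pow, abs_neg, abs_one, one_pow, one_mul]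
    exact (hC A (by simpa using hA)).trans (le_max_left _ _)
  · exact le_max_right _ _

theorem esymm_zero_multiset_mul_pow (j : ℕ) (c : ℝ) :
    (0 : Multiset ℝ).esymm j = c ^ j * (0 : Multiset ℝ).esymm j := by
  cases j with
  | zero => simp
  | succ j => simp [Multiset.esymm, Multiset.powersetCard_zero_right]

theorem operatorEsymm_smul {c : ℝ} (hc : c ≠ 0) (A : E n →L[ℝ] E n) {j : ℕ} (hj : j ≤ n) :
    operatorEsymm j (c • A) = c ^ j * operatorEsymm j A := by
  have hs : ((c • A : E n →L[ℝ] E n) : E n →ₗ[ℝ] E n).IsSymmetric ↔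
      (A : E n →ₗ[ℝ] E n).IsSymmetric := by
    simp [LinearMap.IsSymmetric, inner_smul_left, inner_smul_right, hc]
  unfold operatorEsymm
  by_cases h : (A : E n →ₗ[ℝ] E n).IsSymmetric
  · rw [if_pos h, if_pos (hs.2 h), charpoly_coeff_smul c A hj]; ring
  · rw [if_neg h, if_neg (mt hs.1 h)]
    exact esymm_zero_multiset_mul_pow j c

theorem operatorEsymm_conj (T : E n ≃ₗᵢ[ℝ] E n) {A B : E n →L[ℝ] E n}
    (h : ∀ v, B (T v) = T (A v)) (j : ℕ) : operatorEsymm j B = operatorEsymm j A := by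
  have hB : (B : E n →ₗ[ℝ] E n) = T.toLinearEquiv.conj (A : E n →ₗ[ℝ] E n) := by
    ext1 v
    obtain ⟨w, rfl⟩ := T.surjective v
    simp [LinearEquiv.conj_apply, h]
  have hs : (B : E n →ₗ[ℝ] E n).IsSymmetric ↔ (A : E n →ₗ[ℝ] E n).IsSymmetric := by
    refine T.surjective.forall.trans (forall_congr' fun v =>
      T.surjective.forall.trans (forall_congr' fun w => ?_))
    simp only [ContinuousLinearMap.coe_coe, h, T.inner_map_map]
  unfold operatorEsymm
  by_cases hA : (A : E n →ₗ[ℝ] E n).IsSymmetric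
  · rw [if_pos hA, if_pos (hs.2 hA), hB, LinearEquiv.charpoly_conj]
  · rw [if_neg hA, if_neg (mt hs.1 hA)]

/-! ### The shape operator on the ambient space -/

/-- The map `v ↦ v - ⟪u, v⟫ u`; for a unit vector `u` this is the orthogonal projection onto the
orthogonal complement of `u`. -/
def normalComplProj (u : E n) : E n →L[ℝ] E n :=
  ContinuousLinearMap.id ℝ (E n) - (innerSL ℝ u).smulRight u

theorem normalComplProj_apply (u v : E n) : normalComplProj u v = v - ⟪u, v⟫ • u := by
  simp [normalComplProj]

theorem continuous_normalComplProj : Continuous (normalComplProj : E n → E n →L[ℝ] E n) := by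
  have : Continuous fun u : E n => ContinuousLinearMap.smulRightL ℝ (E n) (E n) (innerSL ℝ u) u := by
    fun_prop
  exact continuous_const.sub this

theorem normalComplProj_eq_starProjection {u : E n} (hu : ‖u‖ = 1) (v : E n) :
    normalComplProj u v = (((ℝ ∙ u)ᗮ).orthogonalProjectionOnto v : E n) := by
  rw [normalComplProj_apply, ← Submodule.starProjection_apply,
    Submodule.starProjection_orthogonal_val, Submodule.starProjection_unit_singleton ℝ hu]

/-- The Weingarten map, extended by `0` in the normal direction to an operator on `ℝⁿ`. It is
written through the extended Gauss map, which makes it a measurable function on `ℝⁿ`. -/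
def shapeOperator (K : Set (E n)) (x : E n) : E n →L[ℝ] E n :=
  normalComplProj (extendedGaussMap K x) ∘L fderiv ℝ (extendedGaussMap K) x ∘L
    normalComplProj (extendedGaussMap K x)

theorem measurable_shapeOperator {r : ℝ} (hK : K ∈ convexBodiesAroundOrigin n)
    (hr : HasInnerRollingBall K r) : Measurable (shapeOperator K) := by
  have h1 : Measurable fun x => normalComplProj (extendedGaussMap K x) :=
    continuous_normalComplProj.measurable.comp (measurable_extendedGaussMap hK hr)
  have h2 := measurable_fderiv ℝ (extendedGaussMap K)
  have hc : Continuous fun q : (E n →L[ℝ] E n) × (E n →L[ℝ] E n) => q.1 ∘L q.2 ∘L q.1 := by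
    fun_prop
  exact hc.measurable.comp (h1.prodMk h2)

theorem exists_norm_shapeOperator_le {r : ℝ} (hK : K ∈ convexBodiesAroundOrigin n)
    (hr : HasInnerRollingBall K r) :
    ∃ C, ∀ x ∈ frontier K, ‖shapeOperator K x‖ ≤ C := by
  obtain ⟨C, hC⟩ := exists_norm_fderiv_extendedGaussMap_le hK hr
  refine ⟨2 * (C * 2), fun x hx => ?_⟩
  have hp : ‖normalComplProj (extendedGaussMap K x)‖ ≤ 2 := by
    refine (norm_sub_le _ _).trans ?_
    rw [ContinuousLinearMap.norm_smulRight_apply, innerSL_apply_norm,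
      extendedGaussMap_of_mem_frontier hK hx, (isOuterUnitNormal_gaussMap hK hr hx).1]
    linarith [ContinuousLinearMap.norm_id_le (𝕜 := ℝ) (E := E n)]
  have hCx := hC x hx
  have hC0 : 0 ≤ C := (norm_nonneg _).trans hCx
  refine (ContinuousLinearMap.opNorm_comp_le _ _).trans ?_
  gcongr
  refine (ContinuousLinearMap.opNorm_comp_le _ _).trans ?_
  gcongr

theorem shapeOperator_eq_comp_weingartenMap {r : ℝ} (hK : K ∈ convexBodiesAroundOrigin n)
    (hr : HasInnerRollingBall K r) {x : E n} (hx : x ∈ frontier K) :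
    shapeOperator K x = (tangentSpace K x).subtypeL ∘L weingartenMap K x ∘L
      (tangentSpace K x).orthogonalProjectionOnto := by
  have hu := isOuterUnitNormal_gaussMap hK hr hx
  ext1 v
  rw [shapeOperator, extendedGaussMap_of_mem_frontier hK hx]
  simp only [ContinuousLinearMap.comp_apply, weingartenMap, Submodule.subtypeL_apply]
  rw [normalComplProj_eq_starProjection hu.1, normalComplProj_eq_starProjection hu.1,
    fderivWithin_gaussMap_apply hK hr hx]
  exact Submodule.mem_orthogonal_singleton_iff_inner_right.1 (Submodule.coe_mem _)

theorem finrank_tangentSpace_add_one {x : E n} (h : ‖gaussMap K x‖ = 1) :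
    Module.finrank ℝ (tangentSpace K x) + 1 = n := by
  change Module.finrank ℝ (ℝ ∙ gaussMap K x)ᗮ + 1 = n
  have h0 : gaussMap K x ≠ 0 := by rintro h'; simp [h'] at h
  have := (ℝ ∙ gaussMap K x).finrank_add_finrank_orthogonal
  rw [finrank_span_singleton h0, finrank_euclideanSpace_fin] at this
  omega

/-- Vieta's formula for the Weingarten map `W` at `x`, together with `char(ι W π) = X · char(W)` for the
inclusion `ι` of the tangent hyperplane and the orthogonal projection `π` onto it. -/
theorem esymm_principalCurvatures {r : ℝ} (hK : K ∈ convexBodiesAroundOrigin n)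
    (hr : HasInnerRollingBall K r) {x : E n} (hx : x ∈ frontier K) {j : ℕ} (hj : j ≤ n - 1) :
    (principalCurvatures K x).esymm j = operatorEsymm j (shapeOperator K x) := by
  have hu := isOuterUnitNormal_gaussMap hK hr hx
  have hdim := finrank_tangentSpace_add_one hu.1
  have hA := shapeOperator_eq_comp_weingartenMap hK hr hx
  have hs : (shapeOperator K x : E n →ₗ[ℝ] E n).IsSymmetric ↔
      (weingartenMap K x : tangentSpace K x →ₗ[ℝ] tangentSpace K x).IsSymmetric := by
    have hin : ∀ (v : tangentSpace K x) (w : E n),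
        ⟪(v : E n), w⟫ = ⟪v, (tangentSpace K x).orthogonalProjectionOnto w⟫ := fun v w => by
      exact (Submodule.inner_orthogonalProjectionOnto_eq_of_mem_left v w).symm
    have hin' : ∀ (v : tangentSpace K x) (w : E n),
        ⟪w, (v : E n)⟫ = ⟪(tangentSpace K x).orthogonalProjectionOnto w, v⟫ := fun v w => by
      rw [real_inner_comm, hin, real_inner_comm]
    simp only [LinearMap.IsSymmetric, hA, ContinuousLinearMap.coe_coe,
      ContinuousLinearMap.comp_apply, Submodule.subtypeL_apply]
    constructor
    · intro h v w
      have := h v w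
      rwa [hin, hin', Submodule.orthogonalProjectionOnto_mem_subspace_eq_self,
        Submodule.orthogonalProjectionOnto_mem_subspace_eq_self] at this
    · intro h v w
      rw [hin, hin', h]
  unfold principalCurvatures operatorEsymm
  by_cases h : (weingartenMap K x : tangentSpace K x →ₗ[ℝ] tangentSpace K x).IsSymmetric
  · rw [dif_pos h, if_pos (hs.2 h)]
    set P := (Finset.univ.val.map (h.eigenvalues rfl) : Multiset ℝ) with hP
    have hcard : Multiset.card P = n - 1 := by
      simp [hP]; omega
    have hW : (weingartenMap K x : tangentSpace K x →ₗ[ℝ] tangentSpace K x).charpoly =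
        (P.map fun t => Polynomial.X - Polynomial.C t).prod := by
      rw [h.charpoly_eq rfl, hP, Multiset.map_map]
      rfl
    have hc := charpoly_comp_comm (tangentSpace K x).subtype
      ((weingartenMap K x : tangentSpace K x →ₗ[ℝ] tangentSpace K x) ∘ₗ
        ((tangentSpace K x).orthogonalProjectionOnto : E n →ₗ[ℝ] tangentSpace K x))
    have e1 : (tangentSpace K x).subtype ∘ₗ
        ((weingartenMap K x : tangentSpace K x →ₗ[ℝ] tangentSpace K x) ∘ₗ
        ((tangentSpace K x).orthogonalProjectionOnto : E n →ₗ[ℝ] tangentSpace K x)) =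
        (shapeOperator K x : E n →ₗ[ℝ] E n) := by
      rw [hA]; rfl
    have e2 : ((weingartenMap K x : tangentSpace K x →ₗ[ℝ] tangentSpace K x) ∘ₗ
        ((tangentSpace K x).orthogonalProjectionOnto : E n →ₗ[ℝ] tangentSpace K x)) ∘ₗ
        (tangentSpace K x).subtype = weingartenMap K x := by
      ext1 v
      simp
    rw [e1, e2, finrank_euclideanSpace_fin, hW] at hc
    have hco := congrArg (fun q => Polynomial.coeff q (n - j + (n - 1))) hc
    have hd : Module.finrank ℝ (tangentSpace K x) = n - 1 := by omega
    simp only [hd] at hco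
    rw [mul_comm, Polynomial.coeff_mul_X_pow, show n - j + (n - 1) = (n - 1 - j) + n by omega,
      mul_comm, Polynomial.coeff_mul_X_pow, Multiset.prod_X_sub_C_coeff P (by omega), hcard,
      show n - 1 - (n - 1 - j) = j by omega] at hco
    rw [hco, ← mul_assoc, ← pow_add, ← two_mul, pow_mul]
    simp
  · rw [dif_neg h, if_neg (mt hs.1 h)]

/-- On `∂K` the normalized curvatures are measurable functions of the ambient shape operator. -/
theorem normalizedCurvature_eq {r : ℝ} (hK : K ∈ convexBodiesAroundOrigin n)
    (hr : HasInnerRollingBall K r) {x : E n} (hx : x ∈ frontier K) {j : ℕ} (hj : j ≤ n - 1) :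
    normalizedCurvature K j x =
      ((n - 1).choose j : ℝ)⁻¹ * operatorEsymm j (shapeOperator K x) := by
  rw [normalizedCurvature, esymm_principalCurvatures hK hr hx hj]

/-! ### Finiteness of the surface area -/

/-- Boundary points whose normals lie in a common cap around the direction `e` are separated by the
projection along `e`: each of them lies below the supporting hyperplane of the other. -/
theorem norm_sub_le_of_isOuterUnitNormal {x y u v e : E n} {c : ℝ} (hc : 0 < c) (he : ‖e‖ = 1)
    (hx : x ∈ K) (hy : y ∈ K) (hu : IsOuterUnitNormal K x u) (hv : IsOuterUnitNormal K y v)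
    (hue : c ≤ ⟪e, u⟫) (hve : c ≤ ⟪e, v⟫) :
    ‖x - y‖ ≤ (1 + c⁻¹) * ‖normalComplProj e (x - y)‖ := by
  have key : ∀ {d w : E n}, ‖w‖ = 1 → c ≤ ⟪e, w⟫ → ⟪d, w⟫ ≤ 0 →
      ⟪e, d⟫ ≤ c⁻¹ * ‖normalComplProj e d‖ := by
    intro d w hw hew hd
    have h1 : ⟪normalComplProj e d, w⟫ + ⟪e, d⟫ * ⟪e, w⟫ ≤ 0 := by
      rw [normalComplProj_apply, inner_sub_left, inner_smul_left]
      simpa using hd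
    have h2 := neg_le_of_abs_le (abs_real_inner_le_norm (normalComplProj e d) w)
    rw [hw, mul_one] at h2
    rcases le_total ⟪e, d⟫ 0 with h | h
    · exact h.trans (by positivity)
    · rw [inv_mul_eq_div, le_div_iff₀ hc]
      nlinarith [mul_le_mul_of_nonneg_left hew h]
  have h1 := key hv.1 hve (hv.2 x hx)
  have h2 := key hu.1 hue (hu.2 y hy)
  rw [← neg_sub x y, map_neg, norm_neg, inner_neg_right] at h2
  have h3 : |⟪e, x - y⟫| ≤ c⁻¹ * ‖normalComplProj e (x - y)‖ := abs_le.2 ⟨by linarith, h1⟩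
  calc ‖x - y‖ = ‖normalComplProj e (x - y) + ⟪e, x - y⟫ • e‖ := by
        rw [normalComplProj_apply, sub_add_cancel]
    _ ≤ ‖normalComplProj e (x - y)‖ + |⟪e, x - y⟫| := by
        refine (norm_add_le _ _).trans ?_
        rw [norm_smul, he, mul_one, Real.norm_eq_abs]
    _ ≤ _ := by linarith

/-- Near `x` the boundary is the image of a bounded subset of the tangent hyperplane at `x` under a
Lipschitz map, the inverse of the orthogonal projection. -/
theorem hausdorffMeasure_frontier_lt_top {r : ℝ} (hK : K ∈ convexBodiesAroundOrigin n)
    (hr : HasInnerRollingBall K r) : μH[((n - 1 : ℕ) : ℝ)] (frontier K) < ⊤ := by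
  have hcl := hK.2.1.isClosed
  have hcomp : IsCompact (frontier K) := hK.2.1.of_isClosed_subset isClosed_frontier
    hcl.frontier_subset
  refine hcomp.measure_lt_top_of_nhdsWithin fun x hx => ?_
  have hu := isOuterUnitNormal_gaussMap hK hr hx
  set e := gaussMap K x with he
  set S : Set (E n) := {y | y ∈ frontier K ∧ (1 / 2 : ℝ) < ⟪e, gaussMap K y⟫} with hS
  refine ⟨S, ?_, ?_⟩
  · have hc : ContinuousOn (fun y => ⟪e, gaussMap K y⟫) (frontier K) :=
      continuousOn_const.inner (continuousOn_gaussMap hK hr)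
    have h1 : (1 / 2 : ℝ) < ⟪e, gaussMap K x⟫ := by
      rw [← he, real_inner_self_eq_norm_sq, hu.1]; norm_num
    exact Filter.inter_mem self_mem_nhdsWithin ((hc x hx).eventually (lt_mem_nhds h1))
  · let f : S → tangentSpace K x := fun y => (tangentSpace K x).orthogonalProjectionOnto y
    have hf : AntilipschitzWith 3 f := AntilipschitzWith.of_le_mul_dist fun y z => by
      rw [Subtype.dist_eq, dist_eq_norm, dist_eq_norm, ← map_sub, Submodule.coe_norm,
        ← normalComplProj_eq_starProjection hu.1]
      have := norm_sub_le_of_isOuterUnitNormal one_half_pos hu.1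
        (hcl.frontier_subset y.2.1) (hcl.frontier_subset z.2.1)
        (isOuterUnitNormal_gaussMap hK hr y.2.1) (isOuterUnitNormal_gaussMap hK hr z.2.1)
        y.2.2.le z.2.2.le
      norm_num at this ⊢
      exact this
    have hd : (0 : ℝ) ≤ ((n - 1 : ℕ) : ℝ) := Nat.cast_nonneg _
    have hfin : Module.finrank ℝ (tangentSpace K x) = n - 1 := by
      have := finrank_tangentSpace_add_one hu.1
      omega
    have hb : Bornology.IsBounded (f '' univ) := by
      have h1 : Bornology.IsBounded ((tangentSpace K x).orthogonalProjectionOnto '' K) :=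
        (hK.2.1.image (tangentSpace K x).orthogonalProjectionOnto.continuous).isBounded
      refine h1.subset ?_
      rintro _ ⟨y, -, rfl⟩
      exact ⟨y, hcl.frontier_subset y.2.1, rfl⟩
    have hT : μH[((n - 1 : ℕ) : ℝ)] (f '' univ) < ⊤ := by
      have := isAddHaarMeasure_hausdorffMeasure (E := tangentSpace K x)
      rw [hfin] at this
      exact hb.measure_lt_top
    have h1 := hf.le_hausdorffMeasure_image hd univ
    have h2 := (isometry_subtype_coe (s := S)).hausdorffMeasure_image (Or.inl hd) univ
    rw [image_univ, Subtype.range_coe] at h2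
    rw [h2]
    exact h1.trans_lt (ENNReal.mul_lt_top
      (ENNReal.rpow_lt_top_of_nonneg hd ENNReal.coe_ne_top) hT)

theorem euclideanHausdorffMeasure_frontier_lt_top {r : ℝ} (hK : K ∈ convexBodiesAroundOrigin n)
    (hr : HasInnerRollingBall K r) : μHE[n - 1] (frontier K) < ⊤ := by
  rw [Measure.euclideanHausdorffMeasure_def, Measure.smul_apply, ENNReal.smul_def, smul_eq_mul]
  exact ENNReal.mul_lt_top ENNReal.coe_lt_top (hausdorffMeasure_frontier_lt_top hK hr)

/-! ### Integrability of the Steiner integrand -/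

theorem aemeasurable_normalizedCurvature {r : ℝ} (hK : K ∈ convexBodiesAroundOrigin n)
    (hr : HasInnerRollingBall K r) {j : ℕ} (hj : j ≤ n - 1) :
    AEMeasurable (normalizedCurvature K j) (μHE[n - 1].restrict (frontier K)) := by
  refine ⟨fun x => ((n - 1).choose j : ℝ)⁻¹ * operatorEsymm j (shapeOperator K x),
    ((measurable_operatorEsymm j).comp (measurable_shapeOperator hK hr)).const_mul _, ?_⟩
  filter_upwards [ae_restrict_mem isClosed_frontier.measurableSet] with x hx
  exact normalizedCurvature_eq hK hr hx hj

theorem aemeasurable_gaussMap {r : ℝ} (hK : K ∈ convexBodiesAroundOrigin n)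
    (hr : HasInnerRollingBall K r) :
    AEMeasurable (gaussMap K) (μHE[n - 1].restrict (frontier K)) :=
  (continuousOn_gaussMap hK hr).aemeasurable isClosed_frontier.measurableSet

theorem exists_abs_normalizedCurvature_le {r : ℝ} (hK : K ∈ convexBodiesAroundOrigin n)
    (hr : HasInnerRollingBall K r) {j : ℕ} (hj : j ≤ n - 1) :
    ∃ C, ∀ x ∈ frontier K, |normalizedCurvature K j x| ≤ C := by
  obtain ⟨R, hR⟩ := exists_norm_shapeOperator_le hK hr
  obtain ⟨C, hC⟩ := exists_abs_operatorEsymm_le (n := n) j R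
  refine ⟨|((n - 1).choose j : ℝ)⁻¹| * C, fun x hx => ?_⟩
  rw [normalizedCurvature_eq hK hr hx hj, abs_mul]
  gcongr
  exact hC _ (hR x hx)

theorem aemeasurable_steinerIntegrand {r : ℝ} (hK : K ∈ convexBodiesAroundOrigin n)
    (hr : HasInnerRollingBall K r) (p : ℝ) (m k : ℕ) :
    AEMeasurable (steinerIntegrand p m k K) (μHE[n - 1].restrict (frontier K)) := by
  have hN := aemeasurable_gaussMap hK hr
  have hH := fun j (hj : j ≤ n - 1) => aemeasurable_normalizedCurvature hK hr hj
  unfold steinerIntegrand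
  refine (((aemeasurable_id.inner hN).pow_const _).mul ((hH _ le_rfl).pow_const _)).mul ?_
  refine Finset.aemeasurable_fun_sum _ fun i _ => AEMeasurable.const_mul ?_ _
  exact Finset.aemeasurable_fun_prod _ fun j _ => ((hH _ j.2).const_mul _).pow_const _

theorem exists_abs_steinerIntegrand_le {r : ℝ} (hK : K ∈ convexBodiesAroundOrigin n)
    (hr : HasInnerRollingBall K r) {p : ℝ} (hp : 0 ≤ p / (n + p)) (m k : ℕ) :
    ∃ C, ∀ x ∈ frontier K, |steinerIntegrand p m k K x| ≤ C := by
  obtain ⟨ρ, hρ, hle⟩ := exists_pos_le_inner_of_isOuterUnitNormal hK.2.2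
  obtain ⟨M, hM⟩ := hK.2.1.isBounded.exists_norm_le
  choose B hB using fun j (hj : j ≤ n - 1) => exists_abs_normalizedCurvature_le hK hr hj
  set s : ℝ := (m : ℝ) - k + n * (1 - p) / (n + p) with hs
  -- The support function takes its values in the compact interval `[ρ, M]`, which misses `0`.
  obtain ⟨C₁, hC₁⟩ := isCompact_Icc.exists_bound_of_continuousOn (s := Icc ρ M)
    (f := fun t : ℝ => t ^ s)
    (continuousOn_id.rpow_const fun t ht => Or.inl (hρ.trans_le ht.1).ne')
  refine ⟨C₁ * (B (n - 1) le_rfl) ^ (p / (n + p)) * ∑ i ∈ indexTuples n m, |tupleCoeff n p i| *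
    ∏ j : Fin (n - 1), (((n - 1).choose ((j : ℕ) + 1) : ℝ) * B (j + 1) j.2) ^ i j,
    fun x hx => ?_⟩
  have hu := isOuterUnitNormal_gaussMap hK hr hx
  have h1 : |⟪x, gaussMap K x⟫ ^ s| ≤ C₁ := by
    refine hC₁ _ ⟨hle x _ hu, (real_inner_le_norm _ _).trans ?_⟩
    rw [hu.1, mul_one]
    exact hM x (hK.2.1.isClosed.frontier_subset hx)
  have hC₁0 : 0 ≤ C₁ := (abs_nonneg _).trans h1
  have h2 : |normalizedCurvature K (n - 1) x ^ (p / (n + p))| ≤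
      (B (n - 1) le_rfl) ^ (p / (n + p)) :=
    (Real.abs_rpow_le_abs_rpow _ _).trans
      (Real.rpow_le_rpow (abs_nonneg _) (hB _ le_rfl x hx) hp)
  have hB0 := (abs_nonneg _).trans h2
  unfold steinerIntegrand
  rw [abs_mul, abs_mul, ← hs]
  refine mul_le_mul (mul_le_mul h1 h2 (abs_nonneg _) hC₁0) ?_ (abs_nonneg _)
    (mul_nonneg hC₁0 hB0)
  refine (Finset.abs_sum_le_sum_abs _ _).trans (Finset.sum_le_sum fun i _ => ?_)
  rw [abs_mul, Finset.abs_prod]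
  refine mul_le_mul_of_nonneg_left (Finset.prod_le_prod (fun _ _ => abs_nonneg _) fun j _ => ?_)
    (abs_nonneg _)
  rw [abs_pow, abs_mul, Nat.abs_cast]
  have := hB (j + 1) j.2 x hx
  gcongr

theorem integrableOn_steinerIntegrand {r : ℝ} (hK : K ∈ convexBodiesAroundOrigin n)
    (hr : HasInnerRollingBall K r) {p : ℝ} (hp : 0 ≤ p / (n + p)) (m k : ℕ) :
    IntegrableOn (steinerIntegrand p m k K) (frontier K) μHE[n - 1] := by
  obtain ⟨C, hC⟩ := exists_abs_steinerIntegrand_le hK hr hp m k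
  refine IntegrableOn.of_bound (euclideanHausdorffMeasure_frontier_lt_top hK hr)
    (aemeasurable_steinerIntegrand hK hr p m k).aestronglyMeasurable C ?_
  filter_upwards [ae_restrict_mem isClosed_frontier.measurableSet] with x hx
  exact hC x hx

/-! ### Similarities fixing the origin -/

/-- The linear similarity `x ↦ a T x` with ratio `a > 0` and isometric part `T`. -/
def similarity (a : ℝ) (ha : 0 < a) (T : E n ≃ₗᵢ[ℝ] E n) : E n ≃L[ℝ] E n :=
  T.toContinuousLinearEquiv.trans (ContinuousLinearEquiv.smulLeft (Units.mk0 a ha.ne'))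

theorem similarity_apply {a : ℝ} (ha : 0 < a) (T : E n ≃ₗᵢ[ℝ] E n) (x : E n) :
    similarity a ha T x = a • T x := rfl

section

variable {a : ℝ} (ha : 0 < a) (T : E n ≃ₗᵢ[ℝ] E n)

theorem isOuterUnitNormal_similarity_iff {x u : E n} :
    IsOuterUnitNormal (similarity a ha T '' K) (similarity a ha T x) (T u) ↔
      IsOuterUnitNormal K x u := by
  simp only [IsOuterUnitNormal, forall_mem_image, similarity_apply, T.norm_map, ← smul_sub,
    ← map_sub, inner_smul_left, T.inner_map_map, conj_trivial]
  exact and_congr_right fun _ => forall₂_congr fun y _ =>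
    ⟨fun h => nonpos_of_mul_nonpos_right h ha, fun h => mul_nonpos_of_nonneg_of_nonpos ha.le h⟩

theorem gaussMap_similarity (x : E n) :
    gaussMap (similarity a ha T '' K) (similarity a ha T x) = T (gaussMap K x) := by
  by_cases h : ∃! u, IsOuterUnitNormal K x u
  · have h' : ∃! u,
        IsOuterUnitNormal (similarity a ha T '' K) (similarity a ha T x) u := by
      obtain ⟨u, hu, huniq⟩ := h
      refine ⟨T u, (isOuterUnitNormal_similarity_iff ha T).2 hu, fun v hv => ?_⟩
      obtain ⟨w, rfl⟩ := T.surjective v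
      rw [huniq w ((isOuterUnitNormal_similarity_iff ha T).1 hv)]
    rw [gaussMap, dif_pos h', gaussMap, dif_pos h]
    exact h'.unique h'.choose_spec.1
      ((isOuterUnitNormal_similarity_iff ha T).2 h.choose_spec.1)
  · have h' : ¬ ∃! u,
        IsOuterUnitNormal (similarity a ha T '' K) (similarity a ha T x) u := by
      rintro ⟨u, hu, huniq⟩
      obtain ⟨w, rfl⟩ := T.surjective u
      exact h ⟨w, (isOuterUnitNormal_similarity_iff ha T).1 hu, fun v hv =>
        T.injective (huniq (T v) ((isOuterUnitNormal_similarity_iff ha T).2 hv))⟩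
    rw [gaussMap, dif_neg h', gaussMap, dif_neg h, map_zero]

theorem gauge_similarity (y : E n) :
    gauge (similarity a ha T '' K) (similarity a ha T y) = gauge K y := by
  simp only [gauge_def', ← map_smul, (similarity a ha T).injective.mem_set_image]

theorem extendedGaussMap_similarity (y : E n) :
    extendedGaussMap (similarity a ha T '' K) (similarity a ha T y) =
      T (extendedGaussMap K y) := by
  rw [extendedGaussMap, radialProj, gauge_similarity, ← map_smul, gaussMap_similarity]
  rfl

theorem fderiv_extendedGaussMap_similarity (x v : E n) :
    fderiv ℝ (extendedGaussMap (similarity a ha T '' K)) (similarity a ha T x) (T v) =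
      a⁻¹ • T (fderiv ℝ (extendedGaussMap K) x v) := by
  have hcomp : extendedGaussMap (similarity a ha T '' K) ∘ similarity a ha T =
      T ∘ extendedGaussMap K := funext fun y => extendedGaussMap_similarity ha T y
  have h := congrArg (fun f => fderiv ℝ f x v) hcomp
  simp only [(similarity a ha T).comp_right_fderiv, T.comp_fderiv] at h
  simp only [ContinuousLinearMap.comp_apply, ContinuousLinearEquiv.coe_coe, similarity_apply,
    map_smul] at h
  rw [eq_inv_smul_iff₀ ha.ne']
  exact h

theorem normalComplProj_map (u v : E n) :
    normalComplProj (T u) (T v) = T (normalComplProj u v) := by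
  simp [normalComplProj_apply]

theorem shapeOperator_similarity (x v : E n) :
    shapeOperator (similarity a ha T '' K) (similarity a ha T x) (T v) =
      T ((a⁻¹ • shapeOperator K x) v) := by
  simp only [shapeOperator, extendedGaussMap_similarity, ContinuousLinearMap.comp_apply,
    normalComplProj_map, fderiv_extendedGaussMap_similarity, map_smul, smul_apply]

theorem frontier_similarity_image :
    frontier (similarity a ha T '' K) = similarity a ha T '' frontier K :=
  ((similarity a ha T).toHomeomorph.image_frontier K).symm

theorem similarity_image_mem_convexBodiesAroundOrigin (hK : K ∈ convexBodiesAroundOrigin n) :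
    similarity a ha T '' K ∈ convexBodiesAroundOrigin n := by
  refine ⟨hK.1.is_linear_image (similarity a ha T).toLinearEquiv.toLinearMap.isLinear,
    hK.2.1.image (similarity a ha T).continuous, ?_⟩
  have h := (similarity a ha T).toHomeomorph.image_interior K
  exact h ▸ ⟨0, hK.2.2, map_zero (similarity a ha T)⟩

theorem HasInnerRollingBall.similarity_image {r : ℝ} (hr : HasInnerRollingBall K r) :
    HasInnerRollingBall (similarity a ha T '' K) (a * r) := by
  refine ⟨mul_pos ha hr.1, fun x hx u hu y hy => ?_⟩
  rw [frontier_similarity_image] at hx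
  obtain ⟨x, hx, rfl⟩ := hx
  obtain ⟨u, rfl⟩ := T.surjective u
  obtain ⟨y, rfl⟩ := (similarity a ha T).surjective y
  rw [isOuterUnitNormal_similarity_iff] at hu
  refine mem_image_of_mem _ (hr.2 x hx u hu ?_)
  rw [mem_closedBall_iff_norm, similarity_apply, similarity_apply, mul_smul, ← smul_sub,
    ← smul_sub, ← map_smul, ← map_sub, ← map_sub, norm_smul, T.norm_map, Real.norm_eq_abs,
    abs_of_pos ha] at hy
  rw [mem_closedBall_iff_norm]
  exact le_of_mul_le_mul_left hy ha

theorem normalizedCurvature_similarity {r : ℝ} (hK : K ∈ convexBodiesAroundOrigin n)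
    (hr : HasInnerRollingBall K r) {x : E n} (hx : x ∈ frontier K) {j : ℕ} (hj : j ≤ n - 1) :
    normalizedCurvature (similarity a ha T '' K) j (similarity a ha T x) =
      a⁻¹ ^ j * normalizedCurvature K j x := by
  have hx' : similarity a ha T x ∈ frontier (similarity a ha T '' K) := by
    rw [frontier_similarity_image]; exact mem_image_of_mem _ hx
  rw [normalizedCurvature_eq (similarity_image_mem_convexBodiesAroundOrigin ha T hK)
      (hr.similarity_image ha T) hx' hj, normalizedCurvature_eq hK hr hx hj,
    operatorEsymm_conj T (shapeOperator_similarity ha T x),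
    operatorEsymm_smul (inv_ne_zero ha.ne') _ (by omega)]
  ring

theorem inner_gaussMap_similarity (x : E n) :
    ⟪similarity a ha T x,
      gaussMap (similarity a ha T '' K) (similarity a ha T x)⟫ =
      a * ⟪x, gaussMap K x⟫ := by
  rw [gaussMap_similarity, similarity_apply, inner_smul_left, T.inner_map_map]
  rfl

/-- For a positive first factor, `Real.mul_rpow` holds for every sign of the second factor. -/
theorem mul_rpow_of_pos {a : ℝ} (ha : 0 < a) (x q : ℝ) : (a * x) ^ q = a ^ q * x ^ q := by
  rcases le_or_gt 0 x with hx | hx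
  · exact Real.mul_rpow ha.le hx
  · rw [Real.rpow_def_of_neg (mul_neg_of_pos_of_neg ha hx), Real.rpow_def_of_neg hx,
      Real.log_mul ha.ne' hx.ne, add_mul, Real.exp_add, Real.rpow_def_of_pos ha]
    ring

theorem steinerIntegrand_similarity {r : ℝ} (hn : 1 ≤ n) (hK : K ∈ convexBodiesAroundOrigin n)
    (hr : HasInnerRollingBall K r) {p : ℝ} (hp : (n : ℝ) + p ≠ 0) (m k : ℕ) {x : E n}
    (hx : x ∈ frontier K) :
    a ^ (n - 1) *
      steinerIntegrand p m k (similarity a ha T '' K) (similarity a ha T x) =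
      a ^ ((n : ℝ) * ((n - p) / (n + p)) - k) * steinerIntegrand p m k K x := by
  unfold steinerIntegrand
  rw [inner_gaussMap_similarity, mul_rpow_of_pos ha,
    normalizedCurvature_similarity ha T hK hr hx le_rfl,
    mul_rpow_of_pos (pow_pos (inv_pos.2 ha) _)]
  -- Each summand has weight `∑ j i_j = m` in the curvatures.
  have hsum : (∑ i ∈ indexTuples n m, tupleCoeff n p i * ∏ j : Fin (n - 1),
      (((n - 1).choose ((j : ℕ) + 1) : ℝ) * normalizedCurvature (similarity a ha T '' K)
        ((j : ℕ) + 1) (similarity a ha T x)) ^ i j) =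
      a⁻¹ ^ m * ∑ i ∈ indexTuples n m, tupleCoeff n p i * ∏ j : Fin (n - 1),
        (((n - 1).choose ((j : ℕ) + 1) : ℝ) * normalizedCurvature K ((j : ℕ) + 1) x) ^ i j := by
    rw [Finset.mul_sum]
    refine Finset.sum_congr rfl fun i hi => ?_
    have hm : ∑ j : Fin (n - 1), ((j : ℕ) + 1) * i j = m := (Finset.mem_filter.1 hi).2
    have : ∀ j : Fin (n - 1), (((n - 1).choose ((j : ℕ) + 1) : ℝ) *
        normalizedCurvature (similarity a ha T '' K) ((j : ℕ) + 1)
          (similarity a ha T x)) ^ i j = a⁻¹ ^ (((j : ℕ) + 1) * i j) *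
        (((n - 1).choose ((j : ℕ) + 1) : ℝ) * normalizedCurvature K ((j : ℕ) + 1) x) ^ i j := by
      intro j
      rw [normalizedCurvature_similarity ha T hK hr hx j.2, pow_mul, ← mul_pow]
      exact congrArg (· ^ i j) (mul_left_comm _ _ _)
    rw [Finset.prod_congr rfl fun j _ => this j, Finset.prod_mul_distrib,
      Finset.prod_pow_eq_pow_sum, hm]
    ring
  rw [hsum]
  -- The weights `n - 1` of the area, `m - k + n (1 - p) / (n + p)` of the support function,
  -- `-(n - 1) p / (n + p)` of the Gauss curvature and `-m` of the sum add up.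
  have hpow : a ^ (n - 1) * (a ^ ((m : ℝ) - k + n * (1 - p) / (n + p)) *
      (a⁻¹ ^ (n - 1)) ^ (p / (n + p)) * a⁻¹ ^ m) =
      a ^ ((n : ℝ) * ((n - p) / (n + p)) - k) := by
    rw [← Real.rpow_natCast a, ← Real.rpow_natCast a⁻¹ (n - 1), ← Real.rpow_natCast a⁻¹ m,
      Real.inv_rpow ha.le, Real.inv_rpow ha.le, ← Real.rpow_neg ha.le, ← Real.rpow_neg ha.le,
      ← Real.rpow_mul ha.le, ← Real.rpow_add ha, ← Real.rpow_add ha, ← Real.rpow_add ha]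
    congr 1
    rw [Nat.cast_sub hn]
    field_simp
    push_cast
    ring
  rw [← hpow]
  ring

/-! ### Change of variables -/

theorem euclideanHausdorffMeasure_similarity_image (d : ℕ) (s : Set (E n)) :
    μHE[d] (similarity a ha T '' s) = ENNReal.ofReal (a ^ d) * μHE[d] s := by
  have h1 : similarity a ha T '' s = a • (T '' s) := by
    rw [← image_smul, image_image]; rfl
  have h2 := Measure.hausdorffMeasure_smul₀ (d := (d : ℝ)) (Nat.cast_nonneg d) ha.ne' (T '' s)
  rw [T.isometry.hausdorffMeasure_image (Or.inl (Nat.cast_nonneg d))] at h2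
  rw [h1, Measure.euclideanHausdorffMeasure_def, Measure.smul_apply, Measure.smul_apply, h2,
    smul_comm, ENNReal.smul_def, smul_eq_mul, NNReal.rpow_natCast]
  congr 1
  rw [ENNReal.ofReal, Real.toNNReal_pow ha.le]
  congr 2
  ext
  simp [abs_of_pos ha, ha.le]

theorem setIntegral_similarity_image (d : ℕ) (s : Set (E n)) (f : E n → ℝ) :
    ∫ x in similarity a ha T '' s, f x ∂μHE[d] =
      a ^ d * ∫ x in s, f (similarity a ha T x) ∂μHE[d] := by
  have hemb : MeasurableEmbedding (similarity a ha T) :=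
    (similarity a ha T).toHomeomorph.measurableEmbedding
  have hmap : (μHE[d] : Measure (E n)) =
      ENNReal.ofReal (a ^ d) • (μHE[d] : Measure (E n)).map (similarity a ha T) := by
    ext t _
    rw [Measure.smul_apply, hemb.map_apply, smul_eq_mul,
      ← euclideanHausdorffMeasure_similarity_image ha T,
      image_preimage_eq _ (similarity a ha T).surjective]
  conv_lhs => rw [hmap]
  rw [Measure.restrict_smul, integral_smul_measure, hemb.setIntegral_map,
    preimage_image_eq _ (similarity a ha T).injective, ENNReal.toReal_ofReal (by positivity),
    smul_eq_mul]

theorem steinerCoeff_similarity {r : ℝ} (hn : 1 ≤ n) (hK : K ∈ convexBodiesAroundOrigin n)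
    (hr : HasInnerRollingBall K r) {p : ℝ} (hp : (n : ℝ) + p ≠ 0) (m k : ℕ) :
    steinerCoeff p m k (similarity a ha T '' K) =
      a ^ ((n : ℝ) * ((n - p) / (n + p)) - k) * steinerCoeff p m k K := by
  unfold steinerCoeff
  rw [frontier_similarity_image, setIntegral_similarity_image, ← integral_const_mul,
    ← integral_const_mul]
  exact setIntegral_congr_fun isClosed_frontier.measurableSet fun x hx =>
    steinerIntegrand_similarity ha T hn hK hr hp m k hx

theorem steinerQuermassintegral_similarity {r : ℝ} (hn : 1 ≤ n)
    (hK : K ∈ convexBodiesAroundOrigin n) (hr : HasInnerRollingBall K r) {p : ℝ}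
    (hp : (n : ℝ) + p ≠ 0) (k : ℕ) :
    steinerQuermassintegral p k (similarity a ha T '' K) =
      a ^ ((n : ℝ) * ((n - p) / (n + p)) - k) * steinerQuermassintegral p k K := by
  unfold steinerQuermassintegral
  rw [Finset.mul_sum]
  refine Finset.sum_congr rfl fun m _ => ?_
  rw [steinerCoeff_similarity ha T hn hK hr hp]
  ring

end

end LpSteiner

end

theorem mainTheorem2 {n : ℕ} (hn : 1 ≤ n) (p : ℝ) (hp : 0 ≤ p ∨ p < -(n : ℝ))
    (K : Set (LpSteiner.E n)) (hK : K ∈ LpSteiner.rollingClass n) (m k : ℕ) :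
    IntegrableOn (LpSteiner.steinerIntegrand p m k K) (frontier K) μHE[n - 1] ∧
    (∀ a : ℝ, 0 < a →
      LpSteiner.steinerCoeff p m k (a • K) =
          a ^ ((n : ℝ) * ((n - p) / (n + p)) - k) * LpSteiner.steinerCoeff p m k K ∧
      LpSteiner.steinerQuermassintegral p k (a • K) =
          a ^ ((n : ℝ) * ((n - p) / (n + p)) - k) * LpSteiner.steinerQuermassintegral p k K) ∧
    (∀ T : LpSteiner.E n ≃ₗᵢ[ℝ] LpSteiner.E n,
      LpSteiner.steinerCoeff p m k (T '' K) = LpSteiner.steinerCoeff p m k K ∧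
      LpSteiner.steinerQuermassintegral p k (T '' K) =
        LpSteiner.steinerQuermassintegral p k K) := by
  obtain ⟨hbody, ⟨r, hr⟩, -⟩ := hK
  have hn' : (1 : ℝ) ≤ n := by exact_mod_cast hn
  have hp0 : (n : ℝ) + p ≠ 0 := by
    rcases hp with h | h
    · exact (by linarith : (0 : ℝ) < n + p).ne'
    · exact (by linarith : (n : ℝ) + p < 0).ne
  have hq : 0 ≤ p / ((n : ℝ) + p) := by
    rcases hp with h | h
    · exact div_nonneg h (by linarith)
    · exact div_nonneg_of_nonpos (by linarith) (by linarith)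
  refine ⟨LpSteiner.integrableOn_steinerIntegrand hbody hr hq m k, fun a ha => ?_, fun T => ?_⟩
  · have e : a • K = LpSteiner.similarity a ha (LinearIsometryEquiv.refl ℝ _) '' K := rfl
    rw [e]
    exact ⟨LpSteiner.steinerCoeff_similarity ha _ hn hbody hr hp0 m k,
      LpSteiner.steinerQuermassintegral_similarity ha _ hn hbody hr hp0 k⟩
  · have e : T '' K = LpSteiner.similarity 1 one_pos T '' K :=
      image_congr fun x _ => by rw [LpSteiner.similarity_apply, one_smul]
    rw [e]
    have h1 := LpSteiner.steinerCoeff_similarity one_pos T hn hbody hr hp0 m k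
    have h2 := LpSteiner.steinerQuermassintegral_similarity one_pos T hn hbody hr hp0 k
    rw [Real.one_rpow, one_mul] at h1 h2
    exact ⟨h1, h2⟩
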